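/- Let $d\ge 0$ and let $\mathrm M$ be the set of locally finite Borel measures on $\mathbb R^d$, with the $\sigma$-algebra generated by the maps $\xi\mapsto\xi(K)$, $K$ compact. For $t\in\mathbb R^d$ let $\tau_t\xi=\xi(\,\cdot+t)$. A measure $\mathrm P$ on $\mathrm M$ is stationary if $\tau_t\circ\mathrm P=\mathrm P$ for all $t$ (where $f\circ m$ denotes push-forward of $m$ by $f$), and $\mathrm P_0$ is its Palm measure if $$\mathrm P_0(A)=\int_{\mathrm M}\int_{\mathbb R^d}\omega(t)\,\mathbf 1(\tau_t\xi\in A)\,\xi(\mathrm dt)\,\mathrm P(\mathrm d\xi)$$ for all measurable $A\subset \mathrm M$ and all measurable $\omega:\mathbb R^d\to\mathbb R_+$ with $\int\omega(t)\,\mathrm dt=1$. Let $\mathrm F$ be the set of continuous $B:\mathbb R^d\to\mathbb R^d$ with $B_0=0$ such that, for every $\xi\in\mathrm M$, the push-forward $\xi_B$ of $\xi$ by $t\mapsto t+B_t$ is locally finite; equip $\mathrm F$ with its cylindrical $\sigma$-algebra. A measure $\nu$ on $\mathrm F$ is weakly stationary if for every $t$ it is invariant under $B\mapsto(B_{t+s}-B_t)_{s\in\mathbb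 R^d}$. Let $\mathrm P_0$ be the Palm measure of a $\sigma$-finite stationary measure $\mathrm P$ on $\mathrm M$, let $\nu$ be a $\sigma$-finite weakly stationary measure on $\mathrm F$, and let $\mathrm P_0^\nu$ be the push-forward of $\mathrm P_0\otimes\nu$ by $(\xi,B)\mapsto\xi_B$. Suppose that $\mathrm P_0^\nu$ is $\sigma$-finite and is supported on simple counting measures, i.e. $\mathrm P_0^\nu$-almost every $\eta$ is of the form $\eta=\sum_{x\in S}\delta_x$ with $S\subset\mathbb R^d$ a locally finite set. Then there is a unique $\sigma$-finite stationary measure $\mathrm P^\nu$ on $\mathrm M$ that gives no mass to the zero measure and has Palm measure $\mathrm P_0^\nu$; and $\mathrm P^\nu$ is finite if and only if $$\int_{\mathrm M\times\mathrm F}\mathrm{Vol}\big(V_0(\xi_B)\big)\,(\mathrm P_0\otimes\nu)(\mathrm d\xi,\mathrm dB)<+\infty,$$ where $\mathrm{Vol}$ is Lebesgue measure and $V_0(\eta)=\{t\in\mathbb R^d: |t|\le|t-y|\text{ for every atom }y\text{ of }\eta\}$ is the Voronoi cell of $0$. -/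

import Mathlib

open MeasureTheory
open scoped NNReal ENNReal

noncomputable section

namespace PerturbedPalm

/-- The group `ℝ^d`, with its Euclidean norm and Lebesgue measure. -/
abbrev Rd (d : ℕ) : Type := EuclideanSpace ℝ (Fin d)

/-- The space `M(ℝ^d)` of locally finite Borel measures: finite on every compact set. -/
@[ext]
structure LFMeasure (d : ℕ) : Type where
  toMeasure : Measure (Rd d)
  lt_top_of_isCompact : ∀ K : Set (Rd d), IsCompact K → toMeasure K < ∞

/-- The σ-algebra on `M(ℝ^d)` generated by the maps `ξ ↦ ξ(K)`, `K` compact. -/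
instance (d : ℕ) : MeasurableSpace (LFMeasure d) :=
  ⨆ K : {K : Set (Rd d) // IsCompact K},
    MeasurableSpace.comap (fun ξ : LFMeasure d => ξ.toMeasure K.1) inferInstance

/-- The zero measure, i.e. the empty configuration. -/
instance (d : ℕ) : Zero (LFMeasure d) := ⟨⟨0, fun K _ => by simp⟩⟩

/-- The translation `τ_t ξ = ξ(· + t)`, i.e. the push-forward of `ξ` by `s ↦ s - t`. -/
def translate {d : ℕ} (t : Rd d) (ξ : LFMeasure d) : LFMeasure d where
  toMeasure := ξ.toMeasure.map (fun s => s - t)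
  lt_top_of_isCompact K hK := by
    rw [Measure.map_apply (by fun_prop) hK.measurableSet]
    exact ξ.lt_top_of_isCompact _ ((Homeomorph.subRight t).isCompact_preimage.2 hK)

/-- `P` is stationary: its law is invariant under all translations. -/
def IsStationary {d : ℕ} (P : Measure (LFMeasure d)) : Prop :=
  ∀ t : Rd d, P.map (translate t) = P

/-- `P₀` is the Palm measure of `P`:
`P₀(A) = ∫∫ ω(t) 1(τ_t ξ ∈ A) ξ(dt) P(dξ)` for every measurable `ω ≥ 0` with `∫ ω(t) dt = 1`. -/
def IsPalmMeasure {d : ℕ} (P P₀ : Measure (LFMeasure d)) : Prop :=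
  ∀ ω : Rd d → ℝ≥0, Measurable ω → ∫⁻ t, (ω t : ℝ≥0∞) = 1 →
    ∀ A : Set (LFMeasure d), MeasurableSet A →
      P₀ A = ∫⁻ ξ, ∫⁻ t, (ω t : ℝ≥0∞) * A.indicator 1 (translate t ξ) ∂ξ.toMeasure ∂P

/-- `P` is a σ-finite stationary measure without mass at the zero measure, and its Palm
measure is `P₀`. -/
structure IsStationaryWithPalm {d : ℕ} (P P₀ : Measure (LFMeasure d)) : Prop where
  sigmaFinite : SigmaFinite P
  stationary : IsStationary P
  zero : P {0} = 0
  palm : IsPalmMeasure P P₀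

/-- The space `F(ℝ^d)` of continuous `B : ℝ^d → ℝ^d` with `B 0 = 0` such that the push-forward
by `t ↦ t + B t` of every locally finite measure is locally finite. -/
@[ext]
structure Field (d : ℕ) : Type where
  toFun : Rd d → Rd d
  continuous_toFun : Continuous toFun
  map_zero : toFun 0 = 0
  lt_top_of_isCompact : ∀ ξ : LFMeasure d, ∀ K : Set (Rd d), IsCompact K →
    ξ.toMeasure {t | t + toFun t ∈ K} < ∞

/-- The cylindrical σ-algebra on `F(ℝ^d)`, generated by the evaluations `B ↦ B t`. -/
instance (d : ℕ) : MeasurableSpace (Field d) :=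
  ⨆ t : Rd d, MeasurableSpace.comap (fun B : Field d => B.toFun t) inferInstance

/-- The shift `θ_t B = (B (t + s) - B t)_s`. -/
def Field.shift {d : ℕ} (t : Rd d) (B : Field d) : Field d where
  toFun s := B.toFun (t + s) - B.toFun t
  continuous_toFun := by
    have := B.continuous_toFun
    fun_prop
  map_zero := by simp
  lt_top_of_isCompact ξ K hK := by
    have hB := B.continuous_toFun
    have hK' : IsCompact ((fun x => x - (t + B.toFun t)) ⁻¹' K) :=
      (Homeomorph.subRight (t + B.toFun t)).isCompact_preimage.2 hK
    have h := B.lt_top_of_isCompact (translate (-t) ξ) _ hK'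
    have hm : MeasurableSet {u | u + B.toFun u ∈ (fun x => x - (t + B.toFun t)) ⁻¹' K} :=
      (show Measurable fun u => u + B.toFun u from
        (continuous_id.add hB).measurable) hK'.measurableSet
    rw [translate, Measure.map_apply (by fun_prop) hm] at h
    convert h using 2
    ext s
    simp only [Set.mem_ofPred_eq, Set.mem_preimage, sub_neg_eq_add]
    rw [add_comm s t]
    congr! 1
    abel

/-- `ν` is weakly stationary: its law has stationary increments. -/
def IsWeaklyStationary {d : ℕ} (ν : Measure (Field d)) : Prop :=
  ∀ t : Rd d, ν.map (Field.shift t) = ν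

/-- `ξ_B = Γ(ξ, B)`, the push-forward of `ξ` by `t ↦ t + B t`. -/
def perturb {d : ℕ} (ξ : LFMeasure d) (B : Field d) : LFMeasure d where
  toMeasure := ξ.toMeasure.map (fun t => t + B.toFun t)
  lt_top_of_isCompact K hK := by
    have hB := B.continuous_toFun
    rw [Measure.map_apply (show Continuous fun t => t + B.toFun t from
      continuous_id.add hB).measurable hK.measurableSet]
    exact B.lt_top_of_isCompact ξ K hK

/-- `P₀^ν = Γ ∘ (P₀ ⊗ ν)`, the law of `ξ_B` under `P₀ ⊗ ν`. -/
def perturbedPalm {d : ℕ} (P₀ : Measure (LFMeasure d)) (ν : Measure (Field d)) :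
    Measure (LFMeasure d) :=
  (P₀.prod ν).map (fun p => perturb p.1 p.2)

/-- `ξ` is a simple counting measure: `ξ = ∑_{x ∈ S} δ_x` for a locally finite set `S`. -/
def IsSimpleCounting {d : ℕ} (ξ : LFMeasure d) : Prop :=
  ∃ S : Set (Rd d), (∀ K : Set (Rd d), IsCompact K → (S ∩ K).Finite) ∧
    ξ.toMeasure = Measure.sum (fun x : S => Measure.dirac (x : Rd d))

/-- The set of atoms of `ξ`. -/
def atoms {d : ℕ} (ξ : LFMeasure d) : Set (Rd d) := {y | ξ.toMeasure {y} ≠ 0}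

/-- The Voronoi cell `V_x(ξ)`: the points at least as close to `x` as to every atom of `ξ`. -/
def voronoiCell {d : ℕ} (x : Rd d) (ξ : LFMeasure d) : Set (Rd d) :=
  {t | ∀ y ∈ atoms ξ, ‖t - x‖ ≤ ‖t - y‖}

end PerturbedPalm

end

/-!
The proof rests on two facts about a measure `Q` on configurations.

* The Palm measure of a stationary measure satisfies the Mecke equation `IsMecke`
  (`IsPalmMeasure.isMecke`), a consequence of Campbell's formula (`IsPalmMeasure.campbell`).
* A `σ`-finite `Q` satisfying the Mecke equation and not charging the zero measure is the Palm
  measure of a stationary measure (`IsMecke.isStationaryWithPalm_inversePalm`), provided there is a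
  weight `h ≥ 0` with `∫ h (ξ, s) ξ(ds) = 1` for the configurations `ξ` involved. That measure is
  `f ↦ ∫∫ f(τ_{-s} η) h(τ_{-s} η, s) ds Q(dη)`, and Campbell's formula leaves no other choice
  (`IsPalmMeasure.eq_inversePalm`).

The perturbed measure `P₀^ν` inherits the Mecke equation from `P₀` (`IsMecke.perturbedPalm`). Indeed
`ξ_B` seen from its point `t + B_t` is the configuration `τ_t ξ` perturbed by the field
`B_{t + ·} - B_t`, whose law is again `ν` for fixed `t`; the Mecke equation for `P₀` then applies
with `B` fixed.

For simple counting measures one may take for `h` the weight `voronoiWeight`, which divides a unit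
mass evenly between the atoms nearest to the origin. Ties occur only on bisectors, which are
Lebesgue null, so for almost every `s` the weight `h(τ_{-s} η, s)` is the indicator of `-s` lying in
the Voronoi cell of the origin (`lintegral_voronoiWeight_translate`). The total mass of the
reconstructed measure is therefore the integral of the volume of that cell.
-/

open ProbabilityTheory Set Function

namespace PerturbedPalm

variable {d : ℕ} {α : Type*} [MeasurableSpace α] {P Q : Measure (LFMeasure d)}

/-! ### Measurability on the space of locally finite measures -/

instance (ξ : LFMeasure d) : IsFiniteMeasureOnCompacts ξ.toMeasure :=
  ⟨fun K hK => ξ.lt_top_of_isCompact K hK⟩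

theorem measurable_lfMeasure {f : α → LFMeasure d}
    (h : ∀ K, IsCompact K → Measurable fun a => (f a).toMeasure K) : Measurable f := by
  rw [measurable_iff_comap_le, instMeasurableSpaceLFMeasure, MeasurableSpace.comap_iSup]
  refine iSup_le fun K => ?_
  rw [MeasurableSpace.comap_comp]
  exact (h K.1 K.2).comap_le

theorem measurable_apply_of_isCompact {K : Set (Rd d)} (hK : IsCompact K) :
    Measurable fun ξ : LFMeasure d => ξ.toMeasure K :=
  measurable_iff_comap_le.2 (le_iSup (fun K : {K : Set (Rd d) // IsCompact K} =>
    MeasurableSpace.comap (fun ξ : LFMeasure d => ξ.toMeasure K.1) inferInstance) ⟨K, hK⟩)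

theorem measurable_toMeasure : Measurable (LFMeasure.toMeasure (d := d)) := by
  -- Restricted to a compact ball, the measures are finite and closed sets form a π-system.
  have key (n : ℕ) : Measurable fun ξ : LFMeasure d =>
      ξ.toMeasure.restrict (Metric.closedBall 0 n) := by
    have : ∀ ξ : LFMeasure d, IsFiniteMeasure (ξ.toMeasure.restrict (Metric.closedBall 0 n)) :=
      fun ξ => ⟨by
        simpa using ξ.lt_top_of_isCompact _ (isCompact_closedBall (0 : Rd d) (n : ℝ))⟩
    have aux (s : Set (Rd d)) (hs : IsClosed s) : Measurable fun ξ : LFMeasure d =>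
        ξ.toMeasure.restrict (Metric.closedBall 0 n) s := by
      simp_rw [Measure.restrict_apply hs.measurableSet]
      exact measurable_apply_of_isCompact ((isCompact_closedBall _ _).inter_left hs)
    exact Measurable.measure_of_isPiSystem
      (BorelSpace.measurable_eq.trans borel_eq_generateFrom_isClosed) isPiSystem_isClosed aux
      (aux _ isClosed_univ)
  refine Measure.measurable_of_measurable_coe _ fun s hs => ?_
  have h (ξ : LFMeasure d) : ξ.toMeasure s =
      ⨆ n : ℕ, ξ.toMeasure.restrict (Metric.closedBall 0 n) s := by
    simp_rw [Measure.restrict_apply hs]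
    rw [← Monotone.measure_iUnion, ← inter_iUnion, Metric.iUnion_closedBall_nat, inter_univ]
    exact fun m n hmn => inter_subset_inter_right _
      (Metric.closedBall_subset_closedBall (by exact_mod_cast hmn))
  simp_rw [h]
  exact Measurable.iSup fun n => (Measure.measurable_coe hs).comp (key n)

theorem _root_.ProbabilityTheory.Kernel.isSFiniteKernel_of_forall_lt_top {β : Type*}
    [MeasurableSpace β] (κ : Kernel α β) (h : ∀ a, κ a univ < ∞) : IsSFiniteKernel κ := by
  -- Split `α` according to the integer part of the total mass.
  have hm : Measurable fun a => ⌊(κ a univ).toNNReal⌋₊ :=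
    Nat.measurable_floor.comp (κ.measurable_coe .univ).ennreal_toNNReal
  have hk (k : ℕ) : MeasurableSet {a | ⌊(κ a univ).toNNReal⌋₊ = k} :=
    hm (measurableSet_singleton k)
  classical
  let κ' (k : ℕ) : Kernel α β := Kernel.piecewise (hk k) κ 0
  have hfin (k : ℕ) : IsFiniteKernel (κ' k) := by
    refine ⟨⟨k + 1, by simp, fun a => ?_⟩⟩
    simp only [κ', Kernel.piecewise_apply]
    split_ifs with ha
    · have := (Nat.lt_floor_add_one (κ a univ).toNNReal).le
      rw [ha] at this
      rw [← ENNReal.coe_toNNReal (h a).ne]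
      exact_mod_cast this
    · simp
  have : κ = Kernel.sum κ' := by
    ext a s hs
    rw [Kernel.sum_apply' _ _ hs, tsum_eq_single ⌊(κ a univ).toNNReal⌋₊]
    · simp [κ', Kernel.piecewise_apply]
    · intro k hk
      simp [κ', Kernel.piecewise_apply, hk.symm]
  rw [this]
  exact Kernel.isSFiniteKernel_sum (hκs := fun _ => inferInstance)

/-- The tautological kernel `ξ ↦ ξ` from locally finite measures to points. -/
noncomputable def pointKernel (d : ℕ) : Kernel (LFMeasure d) (Rd d) :=
  ⟨LFMeasure.toMeasure, measurable_toMeasure⟩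

@[simp]
theorem pointKernel_apply (ξ : LFMeasure d) : pointKernel d ξ = ξ.toMeasure := rfl

instance : IsSFiniteKernel (pointKernel d) := by
  let D (n : ℕ) : Set (Rd d) := disjointed (fun n : ℕ => Metric.closedBall (0 : Rd d) n) n
  have hD (n : ℕ) : MeasurableSet (D n) :=
    MeasurableSet.disjointed (fun _ => measurableSet_closedBall) n
  have hU : ⋃ n, D n = univ := by
    rw [iUnion_disjointed, Metric.iUnion_closedBall_nat]
  have hfin (n : ℕ) : IsSFiniteKernel ((pointKernel d).restrict (hD n)) := by
    refine Kernel.isSFiniteKernel_of_forall_lt_top _ fun ξ => ?_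
    rw [Kernel.restrict_apply, Measure.restrict_apply_univ]
    exact (measure_mono (disjointed_subset _ n)).trans_lt
      (ξ.lt_top_of_isCompact _ (isCompact_closedBall (0 : Rd d) (n : ℝ)))
  have : pointKernel d = Kernel.sum fun n => (pointKernel d).restrict (hD n) := by
    ext ξ s hs
    rw [Kernel.sum_apply' _ _ hs]
    simp_rw [Kernel.restrict_apply]
    rw [← Measure.sum_apply _ hs,
      ← Measure.restrict_iUnion (disjoint_disjointed _) hD, hU, Measure.restrict_univ]
  rw [this]
  exact Kernel.isSFiniteKernel_sum (hκs := fun n => hfin n)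

theorem measurable_lintegral_toMeasure {f : α → LFMeasure d} (hf : Measurable f)
    {g : α → Rd d → ℝ≥0∞} (hg : Measurable fun p : α × Rd d => g p.1 p.2) :
    Measurable fun a => ∫⁻ t, g a t ∂(f a).toMeasure :=
  Measurable.lintegral_kernel_prod_right (κ := (pointKernel d).comap f hf) hg

theorem measurable_lintegral_self {g : LFMeasure d → Rd d → ℝ≥0∞}
    (hg : Measurable fun p : LFMeasure d × Rd d => g p.1 p.2) :
    Measurable fun ξ => ∫⁻ t, g ξ t ∂ξ.toMeasure :=
  measurable_lintegral_toMeasure measurable_id hg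

theorem measurable_toMeasure_apply {f : α → LFMeasure d} (hf : Measurable f)
    {s : Set (α × Rd d)} (hs : MeasurableSet s) :
    Measurable fun a => (f a).toMeasure (Prod.mk a ⁻¹' s) :=
  Kernel.measurable_kernel_prodMk_left (κ := (pointKernel d).comap f hf) hs

/-! ### Translations -/

theorem lintegral_translate (t : Rd d) (ξ : LFMeasure d) {g : Rd d → ℝ≥0∞} (hg : Measurable g) :
    ∫⁻ s, g s ∂(translate t ξ).toMeasure = ∫⁻ s, g (s - t) ∂ξ.toMeasure :=
  lintegral_map hg (by fun_prop)

theorem translate_apply (t : Rd d) (ξ : LFMeasure d) {A : Set (Rd d)} (hA : MeasurableSet A) :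
    (translate t ξ).toMeasure A = ξ.toMeasure ((fun s => s - t) ⁻¹' A) :=
  Measure.map_apply (by fun_prop) hA

theorem translate_translate (s t : Rd d) (ξ : LFMeasure d) :
    translate s (translate t ξ) = translate (t + s) ξ := by
  ext1
  simp only [translate]
  rw [Measure.map_map (by fun_prop) (by fun_prop)]
  congr 1
  ext1 x
  simp only [comp_apply]
  abel

@[simp]
theorem translate_zero_left (ξ : LFMeasure d) : translate 0 ξ = ξ := by
  ext1
  simp [translate]

@[fun_prop]
theorem measurable_translate {f : α → Rd d} {g : α → LFMeasure d} (hf : Measurable f)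
    (hg : Measurable g) : Measurable fun a => translate (f a) (g a) := by
  refine measurable_lfMeasure fun K hK => ?_
  simp_rw [translate_apply _ _ hK.measurableSet]
  exact measurable_toMeasure_apply hg (s := {p : α × Rd d | p.2 - f p.1 ∈ K})
    (hK.measurableSet.preimage (f := fun p : α × Rd d => p.2 - f p.1) (by fun_prop))

theorem toMeasure_eq_zero_iff {ξ : LFMeasure d} : ξ.toMeasure = 0 ↔ ξ = 0 :=
  ⟨fun h => LFMeasure.ext h, fun h => by rw [h]; rfl⟩

theorem translate_eq_zero_iff {t : Rd d} {ξ : LFMeasure d} : translate t ξ = 0 ↔ ξ = 0 := by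
  rw [← toMeasure_eq_zero_iff, ← toMeasure_eq_zero_iff, translate,
    Measure.map_eq_zero_iff (by fun_prop)]

theorem measurableSet_singleton_zero : MeasurableSet ({0} : Set (LFMeasure d)) := by
  have : ({0} : Set (LFMeasure d)) = {ξ | ξ.toMeasure univ = 0} := by
    ext ξ
    simp [← toMeasure_eq_zero_iff]
  rw [this]
  exact measurableSet_eq_fun ((Measure.measurable_coe .univ).comp measurable_toMeasure)
    measurable_const

/-! ### Campbell's formula and the Mecke equation -/

theorem exists_pos_density (d : ℕ) :
    ∃ ω : Rd d → ℝ≥0, (∀ t, 0 < ω t) ∧ Measurable ω ∧ ∫⁻ t, (ω t : ℝ≥0∞) = 1 := by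
  obtain ⟨g, hg0, hgm, hg⟩ :=
    exists_pos_lintegral_lt_of_sigmaFinite (volume : Measure (Rd d)) one_ne_zero
  set c := ∫⁻ t, (g t : ℝ≥0∞) with hc
  have hctop : c ≠ ∞ := (hg.trans ENNReal.one_lt_top).ne
  have hc0 : c ≠ 0 := by
    rw [hc, Ne, lintegral_eq_zero_iff (by fun_prop)]
    intro h
    obtain ⟨t, ht⟩ := h.exists
    exact (hg0 t).ne' (by simpa using ht)
  have hc' : c.toNNReal ≠ 0 := ENNReal.toNNReal_ne_zero.2 ⟨hc0, hctop⟩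
  refine ⟨fun t => c.toNNReal⁻¹ * g t, fun t => mul_pos (by positivity) (hg0 t), by fun_prop, ?_⟩
  simp_rw [ENNReal.coe_mul]
  rw [lintegral_const_mul _ (by fun_prop), ← hc, ENNReal.coe_inv hc', ENNReal.coe_toNNReal hctop,
    ENNReal.inv_mul_cancel hc0 hctop]

theorem IsStationary.lintegral_translate (hP : IsStationary P) (t : Rd d)
    {f : LFMeasure d → ℝ≥0∞} (hf : Measurable f) :
    ∫⁻ ξ, f (translate t ξ) ∂P = ∫⁻ ξ, f ξ ∂P := by
  conv_rhs => rw [← hP t]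
  rw [lintegral_map hf (by fun_prop)]

theorem IsPalmMeasure.eq_map [SFinite P] (h : IsPalmMeasure P Q) {ω : Rd d → ℝ≥0}
    (hω : Measurable ω) (hω1 : ∫⁻ t, (ω t : ℝ≥0∞) = 1) :
    Q = ((P ⊗ₘ pointKernel d).withDensity fun p => (ω p.2 : ℝ≥0∞)).map
      fun p => translate p.2 p.1 := by
  ext A hA
  have hA' : Measurable (A.indicator (1 : LFMeasure d → ℝ≥0∞)) := measurable_one.indicator hA
  rw [h ω hω hω1 A hA, ← lintegral_indicator_one hA, lintegral_map hA' (by fun_prop),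
    lintegral_withDensity_eq_lintegral_mul _ (by fun_prop) (by fun_prop),
    Measure.lintegral_compProd]
  · rfl
  · simp only [Pi.mul_def]
    fun_prop

theorem IsPalmMeasure.sFinite [SFinite P] (h : IsPalmMeasure P Q) : SFinite Q := by
  obtain ⟨ω, -, hω, hω1⟩ := exists_pos_density d
  rw [h.eq_map hω hω1]
  infer_instance

theorem IsPalmMeasure.lintegral_eq [SFinite P] (h : IsPalmMeasure P Q) {ω : Rd d → ℝ≥0}
    (hω : Measurable ω) (hω1 : ∫⁻ t, (ω t : ℝ≥0∞) = 1) {f : LFMeasure d → ℝ≥0∞}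
    (hf : Measurable f) :
    ∫⁻ η, f η ∂Q = ∫⁻ ξ, ∫⁻ t, (ω t : ℝ≥0∞) * f (translate t ξ) ∂ξ.toMeasure ∂P := by
  rw [h.eq_map hω hω1, lintegral_map hf (by fun_prop),
    lintegral_withDensity_eq_lintegral_mul _ (by fun_prop) (by fun_prop),
    Measure.lintegral_compProd]
  · rfl
  · simp only [Pi.mul_def]
    fun_prop

/-- Campbell's formula. The stationarity of `P` makes a single weight `ω` in the definition of the
Palm measure sufficient. -/
theorem IsPalmMeasure.campbell [SFinite P] (hP : IsStationary P) (h : IsPalmMeasure P Q)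
    {g : LFMeasure d × Rd d → ℝ≥0∞} (hg : Measurable g) :
    ∫⁻ ξ, ∫⁻ u, g (translate u ξ, u) ∂ξ.toMeasure ∂P = ∫⁻ η, ∫⁻ v, g (η, v) ∂volume ∂Q := by
  obtain ⟨ω, -, hω, hω1⟩ := exists_pos_density d
  -- Stationarity moves the integration variable `v` into the weight, which then integrates to one.
  symm
  calc ∫⁻ η, ∫⁻ v, g (η, v) ∂volume ∂Q
      = ∫⁻ ξ, ∫⁻ u, ∫⁻ v, ω u * g (translate u ξ, u - v) ∂volume ∂ξ.toMeasure ∂P := by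
        rw [h.lintegral_eq hω hω1 hg.lintegral_prod_right']
        refine lintegral_congr fun ξ => lintegral_congr fun u => ?_
        rw [lintegral_const_mul _ (by fun_prop),
          lintegral_sub_left_eq_self (fun v => g (translate u ξ, v)) u]
    _ = ∫⁻ ξ, ∫⁻ v, ∫⁻ u, ω u * g (translate u ξ, u - v) ∂ξ.toMeasure ∂volume ∂P := by
        refine lintegral_congr fun ξ => lintegral_lintegral_swap ?_
        simp only [uncurry_def]
        exact Measurable.aemeasurable (by fun_prop)
    _ = ∫⁻ v, ∫⁻ ξ, ∫⁻ u, ω u * g (translate u ξ, u - v) ∂ξ.toMeasure ∂P := by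
        refine lintegral_lintegral_swap (Measurable.aemeasurable ?_)
        exact measurable_lintegral_toMeasure measurable_fst (by fun_prop)
    _ = ∫⁻ v, ∫⁻ ξ, ∫⁻ u, ω (u + v) * g (translate u ξ, u) ∂ξ.toMeasure ∂P := by
        refine lintegral_congr fun v => ?_
        rw [← hP.lintegral_translate v
          (f := fun ξ => ∫⁻ u, ω (u + v) * g (translate u ξ, u) ∂ξ.toMeasure)
          (measurable_lintegral_self (by fun_prop))]
        refine lintegral_congr fun ξ => ?_
        rw [lintegral_translate _ _ (by fun_prop)]
        simp [translate_translate]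
    _ = ∫⁻ ξ, ∫⁻ v, ∫⁻ u, ω (u + v) * g (translate u ξ, u) ∂ξ.toMeasure ∂volume ∂P := by
        refine lintegral_lintegral_swap (Measurable.aemeasurable ?_)
        exact measurable_lintegral_toMeasure measurable_snd (by fun_prop)
    _ = ∫⁻ ξ, ∫⁻ u, ∫⁻ v, ω (u + v) * g (translate u ξ, u) ∂volume ∂ξ.toMeasure ∂P := by
        refine lintegral_congr fun ξ => lintegral_lintegral_swap ?_
        simp only [uncurry_def]
        exact Measurable.aemeasurable (by fun_prop)
    _ = ∫⁻ ξ, ∫⁻ u, g (translate u ξ, u) ∂ξ.toMeasure ∂P := by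
        refine lintegral_congr fun ξ => lintegral_congr fun u => ?_
        rw [lintegral_mul_const _ (by fun_prop),
          lintegral_add_left_eq_self (fun v => (ω v : ℝ≥0∞)) u, hω1, one_mul]

/-- Campbell's formula in terms of the configuration itself and one of its points. -/
theorem IsPalmMeasure.campbell' [SFinite P] (hP : IsStationary P) (h : IsPalmMeasure P Q)
    {g : LFMeasure d × Rd d → ℝ≥0∞} (hg : Measurable g) :
    ∫⁻ ξ, ∫⁻ u, g (ξ, u) ∂ξ.toMeasure ∂P = ∫⁻ η, ∫⁻ s, g (translate (-s) η, s) ∂volume ∂Q := by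
  rw [← h.campbell hP (g := fun p => g (translate (-p.2) p.1, p.2)) (by fun_prop)]
  simp [translate_translate]

/-- The Mecke equation, the intrinsic invariance property of Palm measures: re-rooting at a point
of the configuration preserves the measure of rooted configurations with a second marked point. -/
def IsMecke (Q : Measure (LFMeasure d)) : Prop :=
  ∀ f : LFMeasure d × Rd d → ℝ≥0∞, Measurable f →
    ∫⁻ η, ∫⁻ t, f (translate t η, -t) ∂η.toMeasure ∂Q = ∫⁻ η, ∫⁻ t, f (η, t) ∂η.toMeasure ∂Q

theorem IsPalmMeasure.isMecke [SFinite P] (hP : IsStationary P) (h : IsPalmMeasure P Q) :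
    IsMecke Q := by
  obtain ⟨ω, -, hω, hω1⟩ := exists_pos_density d
  intro f hf
  -- Both sides are double sums over the points `s`, `u` of `ξ`, rooted at `u`; Campbell's formula
  -- makes it irrelevant which of the two points carries the weight `ω`.
  calc ∫⁻ η, ∫⁻ t, f (translate t η, -t) ∂η.toMeasure ∂Q
      = ∫⁻ ξ, ∫⁻ s, ∫⁻ u, ω s * f (translate u ξ, s - u) ∂ξ.toMeasure ∂ξ.toMeasure ∂P := by
        rw [h.lintegral_eq hω hω1 (measurable_lintegral_self (by fun_prop))]
        refine lintegral_congr fun ξ => lintegral_congr fun s => ?_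
        rw [lintegral_const_mul _ (by fun_prop), lintegral_translate _ _ (by fun_prop)]
        simp [translate_translate]
    _ = ∫⁻ ξ, ∫⁻ u, ∫⁻ s, ω s * f (translate u ξ, s - u) ∂ξ.toMeasure ∂ξ.toMeasure ∂P := by
        refine lintegral_congr fun ξ => lintegral_lintegral_swap ?_
        simp only [uncurry_def]
        exact Measurable.aemeasurable (by fun_prop)
    _ = ∫⁻ ξ, ∫⁻ u, (fun p : LFMeasure d × Rd d =>
          ∫⁻ w, ω (w + p.2) * f (p.1, w) ∂p.1.toMeasure) (translate u ξ, u) ∂ξ.toMeasure ∂P := by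
        refine lintegral_congr fun ξ => lintegral_congr fun u => ?_
        simp only
        rw [lintegral_translate _ _ (by fun_prop)]
        simp
    _ = ∫⁻ η, ∫⁻ v, ∫⁻ w, ω (w + v) * f (η, w) ∂η.toMeasure ∂volume ∂Q :=
        h.campbell hP (measurable_lintegral_toMeasure (f := fun p : LFMeasure d × Rd d => p.1)
          (g := fun p w => ω (w + p.2) * f (p.1, w)) measurable_fst (by fun_prop))
    _ = ∫⁻ η, ∫⁻ w, ∫⁻ v, ω (w + v) * f (η, w) ∂volume ∂η.toMeasure ∂Q := by
        refine lintegral_congr fun ξ => lintegral_lintegral_swap ?_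
        simp only [uncurry_def]
        exact Measurable.aemeasurable (by fun_prop)
    _ = ∫⁻ η, ∫⁻ t, f (η, t) ∂η.toMeasure ∂Q := by
        refine lintegral_congr fun ξ => lintegral_congr fun u => ?_
        rw [lintegral_mul_const _ (by fun_prop),
          lintegral_add_left_eq_self (fun v => (ω v : ℝ≥0∞)) u, hω1, one_mul]

theorem IsPalmMeasure.ae_ne_zero (h : IsPalmMeasure P Q) : ∀ᵐ η ∂Q, η ≠ 0 := by
  obtain ⟨ω, -, hω, hω1⟩ := exists_pos_density d
  have h0 : Q {0} = 0 := by
    rw [h ω hω hω1 _ measurableSet_singleton_zero, lintegral_eq_zero_of_ae_eq_zero]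
    refine .of_forall fun ξ => ?_
    -- Only `ξ = 0` has a zero translate, and there the integral against `ξ` vanishes.
    beta_reduce
    by_cases hξ : ξ = 0
    · rw [toMeasure_eq_zero_iff.2 hξ]
      simp
    · simp [indicator, translate_eq_zero_iff, hξ]
  rwa [ae_iff, show {η : LFMeasure d | ¬ η ≠ 0} = {0} by ext; simp]

/-! ### Perturbation by a field with stationary increments -/

theorem measurable_field {f : α → Field d} (h : ∀ t, Measurable fun a => (f a).toFun t) :
    Measurable f := by
  rw [measurable_iff_comap_le, instMeasurableSpaceField, MeasurableSpace.comap_iSup]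
  refine iSup_le fun t => ?_
  rw [MeasurableSpace.comap_comp]
  exact (h t).comap_le

theorem measurable_eval (t : Rd d) : Measurable fun B : Field d => B.toFun t :=
  measurable_iff_comap_le.2 (le_iSup (fun t : Rd d =>
    MeasurableSpace.comap (fun B : Field d => B.toFun t) inferInstance) t)

theorem measurable_toFun_uncurry : Measurable fun p : Rd d × Field d => p.2.toFun p.1 :=
  measurable_uncurry_of_continuous_of_measurable (u := fun t (B : Field d) => B.toFun t)
    (fun B => B.continuous_toFun) measurable_eval

@[fun_prop]
theorem measurable_toFun {f : α → Field d} {g : α → Rd d} (hf : Measurable f)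
    (hg : Measurable g) : Measurable fun a => (f a).toFun (g a) :=
  measurable_toFun_uncurry.comp (hg.prodMk hf)

@[fun_prop]
theorem measurable_shift {f : α → Rd d} {g : α → Field d} (hf : Measurable f)
    (hg : Measurable g) : Measurable fun a => (g a).shift (f a) := by
  refine measurable_field fun t => ?_
  simp only [Field.shift]
  fun_prop

theorem perturb_apply (ξ : LFMeasure d) (B : Field d) {A : Set (Rd d)} (hA : MeasurableSet A) :
    (perturb ξ B).toMeasure A = ξ.toMeasure ((fun t => t + B.toFun t) ⁻¹' A) :=
  Measure.map_apply (by fun_prop) hA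

theorem lintegral_perturb (ξ : LFMeasure d) (B : Field d) {g : Rd d → ℝ≥0∞}
    (hg : Measurable g) :
    ∫⁻ s, g s ∂(perturb ξ B).toMeasure = ∫⁻ t, g (t + B.toFun t) ∂ξ.toMeasure :=
  lintegral_map hg (by fun_prop)

@[fun_prop]
theorem measurable_perturb {f : α → LFMeasure d} {g : α → Field d} (hf : Measurable f)
    (hg : Measurable g) : Measurable fun a => perturb (f a) (g a) := by
  refine measurable_lfMeasure fun K hK => ?_
  simp_rw [perturb_apply _ _ hK.measurableSet]
  exact measurable_toMeasure_apply hf (s := {p : α × Rd d | p.2 + (g p.1).toFun p.2 ∈ K})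
    (hK.measurableSet.preimage (f := fun p : α × Rd d => p.2 + (g p.1).toFun p.2) (by fun_prop))

theorem perturb_eq_zero_iff {ξ : LFMeasure d} {B : Field d} : perturb ξ B = 0 ↔ ξ = 0 := by
  rw [← toMeasure_eq_zero_iff, ← toMeasure_eq_zero_iff, perturb,
    Measure.map_eq_zero_iff (by fun_prop)]

/-- Seen from the displaced position of `t`, the perturbed configuration is the perturbation of
the configuration seen from `t` by the increments of the field at `t`. -/
theorem translate_perturb (t : Rd d) (ξ : LFMeasure d) (B : Field d) :
    translate (t + B.toFun t) (perturb ξ B) = perturb (translate t ξ) (B.shift t) := by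
  ext1
  simp only [translate, perturb]
  rw [Measure.map_map (by fun_prop) (by fun_prop), Measure.map_map (by fun_prop) (by fun_prop)]
  congr 1
  ext1 s
  simp only [comp_apply, Field.shift, add_sub_cancel]
  abel

theorem IsWeaklyStationary.lintegral_shift {ν : Measure (Field d)} (hν : IsWeaklyStationary ν)
    (t : Rd d) {f : Field d → ℝ≥0∞} (hf : Measurable f) :
    ∫⁻ B, f (B.shift t) ∂ν = ∫⁻ B, f B ∂ν := by
  conv_rhs => rw [← hν t]
  rw [lintegral_map hf (by fun_prop)]

theorem lintegral_perturbedPalm {P₀ : Measure (LFMeasure d)} {ν : Measure (Field d)}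
    [SFinite P₀] [SFinite ν] {f : LFMeasure d → ℝ≥0∞} (hf : Measurable f) :
    ∫⁻ η, f η ∂perturbedPalm P₀ ν = ∫⁻ B, ∫⁻ ξ, f (perturb ξ B) ∂P₀ ∂ν := by
  rw [perturbedPalm, lintegral_map hf (by fun_prop), lintegral_prod_symm' _ (by fun_prop)]

/-- Perturbation preserves the Mecke equation: the increments of the field at a point `t` of the
configuration have the law `ν` again, so that `P₀ ⊗ ν` is invariant under re-rooting. -/
theorem IsMecke.perturbedPalm {P₀ : Measure (LFMeasure d)} {ν : Measure (Field d)}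
    [SFinite P₀] [SFinite ν] (hP₀ : IsMecke P₀) (hν : IsWeaklyStationary ν) :
    IsMecke (perturbedPalm P₀ ν) := by
  intro f hf
  have hF : Measurable fun p : Field d × LFMeasure d × Rd d =>
      f (perturb p.2.1 p.1, p.2.2 + p.1.toFun p.2.2) := by fun_prop
  have key (ξ : LFMeasure d) (B : Field d) (t : Rd d) :
      f (translate (t + B.toFun t) (perturb ξ B), -(t + B.toFun t)) =
        f (perturb (translate t ξ) (B.shift t), -t + (B.shift t).toFun (-t)) := by
    rw [translate_perturb]
    simp only [Field.shift, add_neg_cancel, B.map_zero]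
    congr 2
    abel
  calc ∫⁻ η, ∫⁻ t, f (translate t η, -t) ∂η.toMeasure ∂PerturbedPalm.perturbedPalm P₀ ν
      = ∫⁻ B, ∫⁻ ξ, ∫⁻ t, f (perturb (translate t ξ) (B.shift t),
          -t + (B.shift t).toFun (-t)) ∂ξ.toMeasure ∂P₀ ∂ν := by
        rw [lintegral_perturbedPalm (measurable_lintegral_self (by fun_prop))]
        refine lintegral_congr fun B => lintegral_congr fun ξ => ?_
        rw [lintegral_perturb _ _ (by fun_prop)]
        exact lintegral_congr fun t => key ξ B t
    _ = ∫⁻ ξ, ∫⁻ B, ∫⁻ t, f (perturb (translate t ξ) (B.shift t),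
          -t + (B.shift t).toFun (-t)) ∂ξ.toMeasure ∂ν ∂P₀ := by
        refine lintegral_lintegral_swap (Measurable.aemeasurable ?_)
        exact measurable_lintegral_toMeasure measurable_snd (by fun_prop)
    _ = ∫⁻ ξ, ∫⁻ t, ∫⁻ B, f (perturb (translate t ξ) (B.shift t),
          -t + (B.shift t).toFun (-t)) ∂ν ∂ξ.toMeasure ∂P₀ := by
        refine lintegral_congr fun ξ => lintegral_lintegral_swap ?_
        simp only [uncurry_def]
        exact Measurable.aemeasurable (by fun_prop)
    _ = ∫⁻ ξ, ∫⁻ t, ∫⁻ B, f (perturb (translate t ξ) B,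
          -t + B.toFun (-t)) ∂ν ∂ξ.toMeasure ∂P₀ := by
        refine lintegral_congr fun ξ => lintegral_congr fun t => ?_
        exact hν.lintegral_shift t (f := fun B => f (perturb (translate t ξ) B,
          -t + B.toFun (-t))) (by fun_prop)
    _ = ∫⁻ ξ, ∫⁻ t, ∫⁻ B, f (perturb ξ B, t + B.toFun t) ∂ν ∂ξ.toMeasure ∂P₀ :=
        hP₀ (fun p => ∫⁻ B, f (perturb p.1 B, p.2 + B.toFun p.2) ∂ν)
          (Measurable.lintegral_prod_right' (f := fun q : (LFMeasure d × Rd d) × Field d =>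
            f (perturb q.1.1 q.2, q.1.2 + q.2.toFun q.1.2)) (by fun_prop))
    _ = ∫⁻ ξ, ∫⁻ B, ∫⁻ t, f (perturb ξ B, t + B.toFun t) ∂ξ.toMeasure ∂ν ∂P₀ := by
        refine lintegral_congr fun ξ => lintegral_lintegral_swap ?_
        simp only [uncurry_def]
        exact Measurable.aemeasurable (by fun_prop)
    _ = ∫⁻ B, ∫⁻ ξ, ∫⁻ t, f (perturb ξ B, t + B.toFun t) ∂ξ.toMeasure ∂P₀ ∂ν := by
        refine lintegral_lintegral_swap (Measurable.aemeasurable ?_)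
        exact measurable_lintegral_toMeasure measurable_fst (by fun_prop)
    _ = ∫⁻ η, ∫⁻ t, f (η, t) ∂η.toMeasure ∂PerturbedPalm.perturbedPalm P₀ ν := by
        rw [lintegral_perturbedPalm (measurable_lintegral_self (by fun_prop))]
        refine lintegral_congr fun B => lintegral_congr fun ξ => ?_
        rw [lintegral_perturb _ _ (by fun_prop)]

/-! ### Inversion of the Palm measure -/

/-- The measure with Palm measure `Q`, reconstructed by means of a weight `h`: a configuration
`η` rooted at a point is sampled from `Q`, the origin is moved to `-s` with `s` uniform in `ℝ^d`,
and the result `ξ`, in which the former root sits at `s`, is weighted by `h (ξ, s)`. It is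
independent of `h` as long as `∫ h (ξ, s) ξ(ds) = 1`, since `Q` satisfies the Mecke equation. -/
noncomputable def inversePalm (Q : Measure (LFMeasure d)) (h : LFMeasure d × Rd d → ℝ≥0∞) :
    Measure (LFMeasure d) :=
  ((Q.prod volume).withDensity fun p => h (translate (-p.2) p.1, p.2)).map
    fun p => translate (-p.2) p.1

theorem lintegral_inversePalm {h : LFMeasure d × Rd d → ℝ≥0∞} (hh : Measurable h)
    {f : LFMeasure d → ℝ≥0∞} (hf : Measurable f) :
    ∫⁻ ξ, f ξ ∂inversePalm Q h =
      ∫⁻ η, ∫⁻ s, h (translate (-s) η, s) * f (translate (-s) η) ∂volume ∂Q := by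
  rw [inversePalm, lintegral_map hf (by fun_prop),
    lintegral_withDensity_eq_lintegral_mul _ (by fun_prop) (by fun_prop), lintegral_prod]
  · rfl
  · simp only [Pi.mul_def]
    exact Measurable.aemeasurable (by fun_prop)

theorem IsPalmMeasure.eq_inversePalm [SFinite P] (hP : IsStationary P) (hQ : IsPalmMeasure P Q)
    {h : LFMeasure d × Rd d → ℝ≥0∞} (hh : Measurable h)
    (h1 : ∀ᵐ ξ ∂P, ∫⁻ u, h (ξ, u) ∂ξ.toMeasure = 1) : P = inversePalm Q h := by
  refine Measure.ext_of_lintegral _ fun f hf => ?_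
  rw [lintegral_inversePalm hh hf,
    ← hQ.campbell' hP (g := fun p => h p * f p.1) (by fun_prop)]
  refine lintegral_congr_ae (h1.mono fun ξ hξ => ?_)
  simp only
  rw [lintegral_mul_const _ (by fun_prop), hξ, one_mul]

/-- A translation-invariant property, measurable or not, which holds almost surely under the Palm
measure holds almost surely under the stationary measure. -/
theorem IsPalmMeasure.ae_of_ae [SFinite P] (hP : IsStationary P) (hQ : IsPalmMeasure P Q)
    (h0 : P {0} = 0) {p : LFMeasure d → Prop} (hp : ∀ ξ t, p (translate t ξ) → p ξ)
    (h : ∀ᵐ η ∂Q, p η) : ∀ᵐ ξ ∂P, p ξ := by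
  obtain ⟨N, hN, hNm, hN0⟩ := exists_measurable_superset_of_null (ae_iff.1 h)
  have hi : Measurable (N.indicator (1 : LFMeasure d → ℝ≥0∞)) := measurable_one.indicator hNm
  have key : ∫⁻ ξ, ∫⁻ u, N.indicator 1 (translate u ξ) ∂ξ.toMeasure ∂P = 0 := by
    rw [hQ.campbell hP (g := fun p => N.indicator 1 p.1) (by fun_prop),
      lintegral_eq_zero_of_ae_eq_zero]
    filter_upwards [measure_eq_zero_iff_ae_notMem.1 hN0] with η hη
    simp [hη]
  rw [lintegral_eq_zero_iff (measurable_lintegral_self (by fun_prop))] at key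
  filter_upwards [key, measure_eq_zero_iff_ae_notMem.1 h0] with ξ hξ hξ0
  rw [Pi.zero_apply, lintegral_eq_zero_iff (by fun_prop)] at hξ
  have : (ae ξ.toMeasure).NeBot :=
    ae_neBot.2 fun h => hξ0 (toMeasure_eq_zero_iff.1 h)
  obtain ⟨u, hu⟩ := hξ.exists
  refine hp ξ u (by_contra fun hc => ?_)
  have : translate u ξ ∈ N := hN hc
  simp [this] at hu

section Inverse

variable {h : LFMeasure d × Rd d → ℝ≥0∞}

/-- The reconstructed measure satisfies Campbell's formula. -/
theorem IsMecke.campbell_inversePalm [SFinite Q] (hQ : IsMecke Q) (hh : Measurable h)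
    (h1 : ∀ᵐ η ∂Q, ∀ t, ∫⁻ u, h (translate t η, u) ∂(translate t η).toMeasure = 1)
    {g : LFMeasure d × Rd d → ℝ≥0∞} (hg : Measurable g) :
    ∫⁻ ξ, ∫⁻ u, g (ξ, u) ∂ξ.toMeasure ∂inversePalm Q h =
      ∫⁻ η, ∫⁻ s, g (translate (-s) η, s) ∂volume ∂Q := by
  calc ∫⁻ ξ, ∫⁻ u, g (ξ, u) ∂ξ.toMeasure ∂inversePalm Q h
      = ∫⁻ η, ∫⁻ s, ∫⁻ w, h (translate (-s) η, s) * g (translate (-s) η, w + s)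
          ∂η.toMeasure ∂volume ∂Q := by
        rw [lintegral_inversePalm hh (measurable_lintegral_self (by fun_prop))]
        refine lintegral_congr fun η => lintegral_congr fun s => ?_
        rw [lintegral_const_mul _ (by fun_prop), lintegral_translate _ _ (by fun_prop)]
        simp
    _ = ∫⁻ η, ∫⁻ w, ∫⁻ s, h (translate (-s) η, s) * g (translate (-s) η, w + s)
          ∂volume ∂η.toMeasure ∂Q := by
        refine lintegral_congr fun ξ => lintegral_lintegral_swap ?_
        simp only [uncurry_def]
        exact Measurable.aemeasurable (by fun_prop)
    _ = ∫⁻ η, ∫⁻ w, ∫⁻ s, h (translate (-s) (translate w η), s) *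
          g (translate (-s) (translate w η), -w + s) ∂volume ∂η.toMeasure ∂Q :=
        (hQ (fun p => ∫⁻ s, h (translate (-s) p.1, s) * g (translate (-s) p.1, p.2 + s))
          (Measurable.lintegral_prod_right' (f := fun q : (LFMeasure d × Rd d) × Rd d =>
            h (translate (-q.2) q.1.1, q.2) * g (translate (-q.2) q.1.1, q.1.2 + q.2))
            (by fun_prop))).symm
    _ = ∫⁻ η, ∫⁻ w, ∫⁻ s, h (translate (-s) η, w + s) * g (translate (-s) η, s)
          ∂volume ∂η.toMeasure ∂Q := by
        refine lintegral_congr fun η => lintegral_congr fun w => ?_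
        rw [← lintegral_add_left_eq_self _ w]
        simp [translate_translate]
    _ = ∫⁻ η, ∫⁻ s, ∫⁻ w, h (translate (-s) η, w + s) * g (translate (-s) η, s)
          ∂η.toMeasure ∂volume ∂Q := by
        refine lintegral_congr fun ξ => lintegral_lintegral_swap ?_
        simp only [uncurry_def]
        exact Measurable.aemeasurable (by fun_prop)
    _ = ∫⁻ η, ∫⁻ s, g (translate (-s) η, s) ∂volume ∂Q := by
        refine lintegral_congr_ae (h1.mono fun η hη => lintegral_congr fun s => ?_)
        have := hη (-s)
        rw [lintegral_translate _ _ (by fun_prop)] at this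
        simp only [sub_neg_eq_add] at this
        rw [lintegral_mul_const _ (by fun_prop), this, one_mul]

theorem IsMecke.isStationary_inversePalm [SFinite Q] (hQ : IsMecke Q) (hh : Measurable h)
    (h1 : ∀ᵐ η ∂Q, ∀ t, ∫⁻ u, h (translate t η, u) ∂(translate t η).toMeasure = 1) :
    IsStationary (inversePalm Q h) := by
  intro v
  refine Measure.ext_of_lintegral _ fun f hf => ?_
  have hmass : Measurable fun ξ : LFMeasure d => ∫⁻ u, h (translate (-v) ξ, u + v) ∂ξ.toMeasure :=
    measurable_lintegral_self (by fun_prop)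
  calc ∫⁻ ξ, f ξ ∂(inversePalm Q h).map (translate v)
      = ∫⁻ η, ∫⁻ s, h (translate (-s) η, s) * f (translate (v - s) η) ∂volume ∂Q := by
        rw [lintegral_map hf (by fun_prop), lintegral_inversePalm hh (by fun_prop)]
        simp [translate_translate, neg_add_eq_sub]
    _ = ∫⁻ η, ∫⁻ s, h (translate (-v) (translate (-s) η), s + v) * f (translate (-s) η)
          ∂volume ∂Q := by
        refine lintegral_congr fun η => ?_
        rw [← lintegral_add_right_eq_self _ v]
        simp [translate_translate, add_comm]
    _ = ∫⁻ ξ, ∫⁻ u, h (translate (-v) ξ, u + v) * f ξ ∂ξ.toMeasure ∂inversePalm Q h :=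
        (hQ.campbell_inversePalm hh h1
          (g := fun p => h (translate (-v) p.1, p.2 + v) * f p.1) (by fun_prop)).symm
    _ = ∫⁻ ξ, (∫⁻ u, h (translate (-v) ξ, u + v) ∂ξ.toMeasure) * f ξ ∂inversePalm Q h :=
        lintegral_congr fun ξ => lintegral_mul_const _ (by fun_prop)
    _ = ∫⁻ ξ, f ξ ∂inversePalm Q h := by
        rw [lintegral_inversePalm hh (hmass.fun_mul hf), lintegral_inversePalm hh hf]
        refine lintegral_congr_ae (h1.mono fun η hη => lintegral_congr fun s => ?_)
        have := hη (-s + -v)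
        rw [← translate_translate, lintegral_translate _ _ (by fun_prop)] at this
        simp only [sub_neg_eq_add] at this
        rw [this, one_mul]

theorem sigmaFinite_of_lintegral_ne_top {μ : Measure α} {f : α → ℝ≥0∞} (hf : Measurable f)
    (hf0 : ∀ᵐ x ∂μ, f x ≠ 0) (hfi : ∫⁻ x, f x ∂μ ≠ ∞) : SigmaFinite μ := by
  have := isFiniteMeasure_withDensity hfi
  rw [← withDensity_inv_same hf hf0 ((ae_lt_top hf hfi).mono fun _ h => h.ne)]
  refine SigmaFinite.withDensity_of_ne_top
    ((withDensity_absolutelyContinuous μ f).ae_le (hf0.mono fun x hx => ?_))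
  simpa using hx

/-- A measure satisfying the Mecke equation is the Palm measure of the stationary measure
reconstructed from it. -/
theorem IsMecke.isStationaryWithPalm_inversePalm [SigmaFinite Q] (hQ : IsMecke Q)
    (hQ0 : ∀ᵐ η ∂Q, η ≠ 0) (hh : Measurable h)
    (h1 : ∀ᵐ η ∂Q, ∀ t, ∫⁻ u, h (translate t η, u) ∂(translate t η).toMeasure = 1) :
    IsStationaryWithPalm (inversePalm Q h) Q := by
  have hzero : inversePalm Q h {0} = 0 := by
    have hi : Measurable (({0} : Set (LFMeasure d)).indicator (1 : LFMeasure d → ℝ≥0∞)) :=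
      measurable_one.indicator measurableSet_singleton_zero
    rw [← lintegral_indicator_one measurableSet_singleton_zero, lintegral_inversePalm hh hi,
      lintegral_eq_zero_of_ae_eq_zero]
    filter_upwards [hQ0] with η hη
    simp [indicator, translate_eq_zero_iff, hη]
  refine ⟨?_, hQ.isStationary_inversePalm hh h1, hzero, ?_⟩
  · -- Integrating over the points a positive function of the configuration seen from each of them
    -- gives a function which is positive off the zero measure and integrable by Campbell's formula.
    obtain ⟨ω, hω0, hω, hω1⟩ := exists_pos_density d
    obtain ⟨φ, hφ0, hφ, hφ1⟩ := exists_pos_lintegral_lt_of_sigmaFinite Q one_ne_zero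
    refine sigmaFinite_of_lintegral_ne_top
      (f := fun ξ => ∫⁻ s, ω s * φ (translate s ξ) ∂ξ.toMeasure)
      (measurable_lintegral_self (by fun_prop)) ?_ ?_
    · filter_upwards [measure_eq_zero_iff_ae_notMem.1 hzero] with ξ hξ
      rw [Ne, lintegral_eq_zero_iff (by fun_prop)]
      intro hc
      have : (ae ξ.toMeasure).NeBot := ae_neBot.2 fun h => hξ (toMeasure_eq_zero_iff.1 h)
      obtain ⟨u, hu⟩ := hc.exists
      simp [(hω0 u).ne', (hφ0 _).ne'] at hu
    · rw [hQ.campbell_inversePalm hh h1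
        (g := fun p => ω p.2 * φ (translate p.2 p.1)) (by fun_prop)]
      simp only [translate_translate, neg_add_cancel, translate_zero_left]
      refine ((lintegral_congr fun η => ?_).trans_lt hφ1).ne_top
      rw [lintegral_mul_const _ (by fun_prop), hω1, one_mul]
  · intro ω hω hω1 A hA
    have hi : Measurable (A.indicator (1 : LFMeasure d → ℝ≥0∞)) := measurable_one.indicator hA
    rw [hQ.campbell_inversePalm hh h1
      (g := fun p => ω p.2 * A.indicator 1 (translate p.2 p.1)) (by fun_prop),
      ← lintegral_indicator_one hA]
    refine lintegral_congr fun η => ?_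
    simp only [translate_translate, neg_add_cancel, translate_zero_left]
    rw [lintegral_mul_const _ (by fun_prop), hω1, one_mul]

end Inverse

variable {ξ η : LFMeasure d} {S : Set (Rd d)}

/-! ### Simple counting measures -/

/-- `ξ` is the sum of the Dirac masses at the points of the locally finite set `S`. -/
structure IsCountingOn (ξ : LFMeasure d) (S : Set (Rd d)) : Prop where
  finite_inter : ∀ K : Set (Rd d), IsCompact K → (S ∩ K).Finite
  toMeasure_eq : ξ.toMeasure = Measure.sum fun x : S => Measure.dirac (x : Rd d)

theorem isSimpleCounting_iff : IsSimpleCounting ξ ↔ ∃ S, IsCountingOn ξ S :=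
  ⟨fun ⟨S, h₁, h₂⟩ => ⟨S, h₁, h₂⟩, fun ⟨S, h⟩ => ⟨S, h.1, h.2⟩⟩

namespace IsCountingOn

theorem apply (h : IsCountingOn ξ S) {A : Set (Rd d)} (hA : MeasurableSet A) :
    ξ.toMeasure A = ∑' x : S, A.indicator 1 (x : Rd d) := by
  rw [h.toMeasure_eq, Measure.sum_apply _ hA]
  simp_rw [Measure.dirac_apply' _ hA]

theorem apply_eq_zero_iff (h : IsCountingOn ξ S) {A : Set (Rd d)} (hA : MeasurableSet A) :
    ξ.toMeasure A = 0 ↔ ∀ x ∈ S, x ∉ A := by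
  rw [h.apply hA, ENNReal.tsum_eq_zero]
  simp

theorem apply_eq_one (h : IsCountingOn ξ S) {A : Set (Rd d)} (hA : MeasurableSet A) {x : Rd d}
    (hx : x ∈ S) (hxA : x ∈ A) (hu : ∀ y ∈ S, y ∈ A → y = x) : ξ.toMeasure A = 1 := by
  rw [h.apply hA, tsum_eq_single ⟨x, hx⟩]
  · simp [hxA]
  · intro y hy
    exact indicator_of_notMem (fun hyA => hy (Subtype.ext (hu y y.2 hyA))) _

theorem atoms_eq (h : IsCountingOn ξ S) : atoms ξ = S := by
  ext x
  simp [atoms, h.apply_eq_zero_iff (measurableSet_singleton x)]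

theorem nonempty (h : IsCountingOn ξ S) (h0 : ξ ≠ 0) : S.Nonempty := by
  rw [nonempty_iff_ne_empty]
  rintro rfl
  refine h0 (toMeasure_eq_zero_iff.1 (Measure.measure_univ_eq_zero.1 ?_))
  simp [h.apply_eq_zero_iff]

theorem countable (h : IsCountingOn ξ S) : S.Countable := by
  rw [← inter_univ S, ← Metric.iUnion_closedBall_nat (0 : Rd d), inter_iUnion]
  exact countable_iUnion fun n => (h.finite_inter _ (isCompact_closedBall _ _)).countable

theorem translate (h : IsCountingOn ξ S) (t : Rd d) :
    IsCountingOn (translate t ξ) {x | x + t ∈ S} := by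
  refine ⟨fun K hK => ?_, Measure.ext fun A hA => ?_⟩
  · refine Finite.of_finite_image ((h.finite_inter _
      (hK.image (continuous_id.add continuous_const : Continuous fun x => x + t))).subset ?_)
      (add_left_injective t).injOn
    rintro _ ⟨x, ⟨hxS, hxK⟩, rfl⟩
    exact ⟨hxS, x, hxK, rfl⟩
  · let e : {x | x + t ∈ S} ≃ S := (Equiv.addRight t).subtypeEquiv fun _ => Iff.rfl
    rw [translate_apply _ _ hA, h.apply (hA.preimage (by fun_prop)), Measure.sum_apply _ hA,
      ← e.tsum_eq]
    simp_rw [Measure.dirac_apply' _ hA]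
    refine tsum_congr fun x => ?_
    have hx : (e x : Rd d) - t = x := add_sub_cancel_right _ _
    change A.indicator 1 ((e x : Rd d) - t) = A.indicator 1 (x : Rd d)
    rw [hx]

theorem exists_forall_norm_le (h : IsCountingOn ξ S) (h0 : ξ ≠ 0) :
    ∃ x ∈ S, ∀ y ∈ S, ‖x‖ ≤ ‖y‖ := by
  obtain ⟨z, hz⟩ := h.nonempty h0
  obtain ⟨x, ⟨hxS, hx⟩, hmin⟩ := exists_min_image _ (fun y : Rd d => ‖y‖)
    (h.finite_inter _ (isCompact_closedBall 0 ‖z‖)) ⟨z, hz, by simp⟩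
  refine ⟨x, hxS, fun y hy => ?_⟩
  by_cases hyz : ‖y‖ ≤ ‖z‖
  · exact hmin y ⟨hy, by simpa using hyz⟩
  · exact (by simpa using hx : ‖x‖ ≤ ‖z‖).trans (not_le.1 hyz).le

/-- Almost every point has at most one nearest point in a configuration, since the bisector of two
distinct points is a hyperplane. -/
theorem ae_dist_ne (h : IsCountingOn ξ S) :
    ∀ᵐ s : Rd d, ∀ x ∈ S, ∀ y ∈ S, dist s x = dist s y → x = y := by
  rw [ae_ball_iff h.countable]
  intro x hx
  rw [ae_ball_iff h.countable]
  intro y hy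
  by_cases hxy : x = y
  · exact .of_forall fun _ _ => hxy
  · have := Measure.addHaar_affineSubspace (volume : Measure (Rd d))
      (AffineSubspace.perpBisector x y) (by simpa using hxy)
    filter_upwards [measure_eq_zero_iff_ae_notMem.1 this] with s hs hd
    exact absurd (AffineSubspace.mem_perpBisector_iff_dist_eq.2 hd) hs

end IsCountingOn

theorem IsSimpleCounting.translate (h : IsSimpleCounting ξ) (t : Rd d) :
    IsSimpleCounting (translate t ξ) := by
  obtain ⟨S, hS⟩ := isSimpleCounting_iff.1 h
  exact isSimpleCounting_iff.2 ⟨_, hS.translate t⟩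

theorem IsSimpleCounting.of_translate {t : Rd d}
    (h : IsSimpleCounting (PerturbedPalm.translate t ξ)) : IsSimpleCounting ξ := by
  simpa [translate_translate] using h.translate (-t)

/-! ### The Voronoi weight -/

/-- The points of space with no mass of `ξ` strictly closer to the origin; for a simple counting
measure, its atoms in this set are those nearest to the origin. -/
def nearestSet (ξ : LFMeasure d) : Set (Rd d) := {s | ξ.toMeasure (Metric.ball 0 ‖s‖) = 0}

/-- The weight which splits a unit mass evenly between the atoms of `ξ` nearest to the origin. -/
noncomputable def voronoiWeight (p : LFMeasure d × Rd d) : ℝ≥0∞ :=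
  (nearestSet p.1).indicator (fun _ => (p.1.toMeasure (nearestSet p.1))⁻¹) p.2

theorem measurableSet_nearestSet_prod :
    MeasurableSet {p : LFMeasure d × Rd d | p.2 ∈ nearestSet p.1} := by
  refine measurableSet_eq_fun (measurable_toMeasure_apply measurable_fst
    (s := {q : (LFMeasure d × Rd d) × Rd d | q.2 ∈ Metric.ball 0 ‖q.1.2‖}) ?_) measurable_const
  simp only [mem_ball_zero_iff]
  exact measurableSet_lt (by fun_prop) (by fun_prop)

theorem measurableSet_nearestSet (ξ : LFMeasure d) : MeasurableSet (nearestSet ξ) :=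
  measurable_prodMk_left (x := ξ) measurableSet_nearestSet_prod

theorem measurable_voronoiWeight : Measurable (voronoiWeight (d := d)) := by
  have : Measurable fun ξ : LFMeasure d => ξ.toMeasure (nearestSet ξ) :=
    measurable_toMeasure_apply measurable_id measurableSet_nearestSet_prod
  exact Measurable.indicator (f := fun p : LFMeasure d × Rd d =>
    (p.1.toMeasure (nearestSet p.1))⁻¹) (this.comp measurable_fst).inv measurableSet_nearestSet_prod

theorem IsCountingOn.mem_nearestSet_iff (h : IsCountingOn ξ S) {s : Rd d} :
    s ∈ nearestSet ξ ↔ ∀ x ∈ S, ‖s‖ ≤ ‖x‖ := by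
  simp [nearestSet, h.apply_eq_zero_iff Metric.isOpen_ball.measurableSet]

theorem lintegral_voronoiWeight (h : IsSimpleCounting ξ) (h0 : ξ ≠ 0) :
    ∫⁻ s, voronoiWeight (ξ, s) ∂ξ.toMeasure = 1 := by
  obtain ⟨S, hS⟩ := isSimpleCounting_iff.1 h
  obtain ⟨x, hx, hmin⟩ := hS.exists_forall_norm_le h0
  have hpos : ξ.toMeasure (nearestSet ξ) ≠ 0 := by
    rw [Ne, hS.apply_eq_zero_iff (measurableSet_nearestSet ξ)]
    exact fun hc => hc x hx (hS.mem_nearestSet_iff.2 hmin)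
  have htop : ξ.toMeasure (nearestSet ξ) ≠ ∞ := by
    refine ((measure_mono fun s hs => ?_).trans_lt
      (ξ.lt_top_of_isCompact _ (isCompact_closedBall 0 ‖x‖))).ne
    simpa using hS.mem_nearestSet_iff.1 hs x hx
  simp only [voronoiWeight]
  rw [lintegral_indicator_const (measurableSet_nearestSet ξ), ENNReal.inv_mul_cancel hpos htop]

/-- The weight `voronoiWeight (translate (-s) η, s)` is the indicator of `-s` lying in the Voronoi
cell of the origin, except on bisectors. -/
theorem lintegral_voronoiWeight_translate (h : IsSimpleCounting η) (h0 : η ≠ 0) :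
    ∫⁻ s, voronoiWeight (translate (-s) η, s) = volume (voronoiCell 0 η) := by
  obtain ⟨S, hS⟩ := isSimpleCounting_iff.1 h
  have hcell : MeasurableSet (voronoiCell 0 η) := by
    have : voronoiCell 0 η = ⋂ y ∈ atoms η, {t | ‖t - 0‖ ≤ ‖t - y‖} := by
      ext t
      simp [voronoiCell]
    rw [this]
    exact (isClosed_biInter fun y _ => isClosed_le (by fun_prop) (by fun_prop)).measurableSet
  rw [← lintegral_neg_eq_self, ← lintegral_indicator_one hcell]
  refine lintegral_congr_ae (hS.ae_dist_ne.mono fun s hs => ?_)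
  have hT := hS.translate s
  have hT0 : translate s η ≠ 0 := fun hc => h0 (translate_eq_zero_iff.1 hc)
  obtain ⟨x, hx, hmin⟩ := hT.exists_forall_norm_le hT0
  have hone : (translate s η).toMeasure (nearestSet (translate s η)) = 1 := by
    refine hT.apply_eq_one (measurableSet_nearestSet _) hx (hT.mem_nearestSet_iff.2 hmin)
      fun y hy hyn => ?_
    have := hs _ hy _ hx (by
      simpa [dist_eq_norm] using le_antisymm (hT.mem_nearestSet_iff.1 hyn x hx) (hmin y hy))
    exact add_right_cancel this
  have hmem : -s ∈ nearestSet (translate s η) ↔ s ∈ voronoiCell 0 η := by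
    rw [hT.mem_nearestSet_iff]
    simp only [voronoiCell, hS.atoms_eq, mem_ofPred_eq, norm_neg, sub_zero]
    refine ⟨fun H y hy => ?_, fun H x hx => ?_⟩
    · rw [norm_sub_rev]
      exact H (y - s) (by simpa using hy)
    · simpa using H (x + s) hx
  simp only [neg_neg]
  by_cases hm : s ∈ voronoiCell 0 η
  · simp [voronoiWeight, hmem.2 hm, hm, hone]
  · simp [voronoiWeight, mt hmem.1 hm, hm]

end PerturbedPalm

open PerturbedPalm in
theorem mainTheorem7 (d : ℕ)
    (P P₀ : Measure (PerturbedPalm.LFMeasure d)) (hPσ : SigmaFinite P)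
    (hP : PerturbedPalm.IsStationary P) (hP₀ : PerturbedPalm.IsPalmMeasure P P₀)
    (ν : Measure (PerturbedPalm.Field d)) (hνσ : SigmaFinite ν)
    (hν : PerturbedPalm.IsWeaklyStationary ν)
    (hσ : SigmaFinite (PerturbedPalm.perturbedPalm P₀ ν))
    (hs : ∀ᵐ η ∂(PerturbedPalm.perturbedPalm P₀ ν), PerturbedPalm.IsSimpleCounting η) :
    (∃! Pν : Measure (PerturbedPalm.LFMeasure d),
      PerturbedPalm.IsStationaryWithPalm Pν (PerturbedPalm.perturbedPalm P₀ ν)) ∧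
    ∀ Pν : Measure (PerturbedPalm.LFMeasure d),
      PerturbedPalm.IsStationaryWithPalm Pν (PerturbedPalm.perturbedPalm P₀ ν) →
      (IsFiniteMeasure Pν ↔
        ∫⁻ p, volume (PerturbedPalm.voronoiCell 0 (PerturbedPalm.perturb p.1 p.2))
          ∂(P₀.prod ν) < ∞) := by
  have := hP₀.sFinite
  set Q := perturbedPalm P₀ ν with hQ
  have hmecke : IsMecke Q := (hP₀.isMecke hP).perturbedPalm hν
  have hperturb : Measurable fun p : LFMeasure d × Field d => perturb p.1 p.2 := by fun_prop
  have hne : ∀ᵐ η ∂Q, η ≠ 0 := by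
    refine (ae_map_iff hperturb.aemeasurable measurableSet_singleton_zero.compl).2 ?_
    exact (Measure.quasiMeasurePreserving_fst.ae hP₀.ae_ne_zero).mono
      fun p hp => perturb_eq_zero_iff.not.2 hp
  have hone : ∀ᵐ η ∂Q, ∀ t,
      ∫⁻ u, voronoiWeight (translate t η, u) ∂(translate t η).toMeasure = 1 := by
    filter_upwards [hs, hne] with η h h0 t
    exact lintegral_voronoiWeight (h.translate t) (translate_eq_zero_iff.not.2 h0)
  have huniq (Pν : Measure (LFMeasure d)) (h : IsStationaryWithPalm Pν Q) :
      Pν = inversePalm Q voronoiWeight := by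
    have := h.sigmaFinite
    refine h.palm.eq_inversePalm h.stationary measurable_voronoiWeight ?_
    filter_upwards [h.palm.ae_of_ae h.stationary h.zero (fun _ _ => .of_translate) hs,
      measure_eq_zero_iff_ae_notMem.1 h.zero] with ξ hξ h0
    exact lintegral_voronoiWeight hξ h0
  refine ⟨⟨_, hmecke.isStationaryWithPalm_inversePalm hne measurable_voronoiWeight hone, huniq⟩,
    fun Pν h => ?_⟩
  have hmass : Pν univ =
      ∫⁻ p, volume (voronoiCell 0 (perturb p.1 p.2)) ∂(P₀.prod ν) := by
    have hm := measurable_voronoiWeight (d := d)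
    calc Pν univ = ∫⁻ η, ∫⁻ s, voronoiWeight (translate (-s) η, s) ∂volume ∂Q := by
          rw [huniq Pν h, ← lintegral_one, lintegral_inversePalm hm measurable_const]
          simp
      _ = ∫⁻ p, ∫⁻ s, voronoiWeight (translate (-s) (perturb p.1 p.2), s) ∂volume
            ∂(P₀.prod ν) :=
          lintegral_map (Measurable.lintegral_prod_right' (f := fun q : LFMeasure d × Rd d =>
            voronoiWeight (translate (-q.2) q.1, q.2)) (by fun_prop)) hperturb
      _ = _ := by
          refine lintegral_congr_ae ?_
          filter_upwards [ae_of_ae_map hperturb.aemeasurable hs,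
            ae_of_ae_map hperturb.aemeasurable hne] with p hp hp0
          exact lintegral_voronoiWeight_translate hp hp0
  rw [← hmass]
  exact ⟨fun _ => measure_lt_top _ _, fun h => ⟨h⟩⟩
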